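/- Let $K$ be a field, let $q\in K$ with $q\neq 0$, and let $x\in K$ be arbitrary (in particular $q$ and $x$ may be independent indeterminates). Let $(C_n(q))_{n\ge 0}$ be the Carlitz $q$-Catalan numbers, i.e. the unique sequence whose generating function $f(z)=\sum_{n\ge 0}C_n(q)z^n$ satisfies $f(z)=1+z\,f(z)\,f(qz)$. Put $$r(n,x)=\sum_{k=0}^n C_{n-k}(q)\,x^k,\qquad d(n,x)=\det\bigl(r(i+j,x)\bigr)_{i,j=0}^n .$$ Let $F_n(x,s,q)$ be the Carlitz $q$-Fibonacci polynomials, defined by $F_0(x,s,q)=0$, $F_1(x,s,q)=1$ and $F_n(x,s,q)=xF_{n-1}(x,s,q)+q^{n-3}sF_{n-2}(x,s,q)$ for $n\ge 2$, and let $\begin{bmatrix} m\\ k\end{bmatrix}$ denote the Gaussian binomial coefficient (a polynomial in $q$), evaluated at $q$. Then for every $n\ge 0$ we have $d(n,0)\neq 0$ and $$\frac{d(n,x^2)}{d(n,0)}=\frac{(-1)^n}{q^{n^2}}\,F_{2n+1}(x,-q,q)=\sum_{k=0}^n(-1)^{n-k}q^{k^2-n^2}\begin{bmatrix}2n-k\\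 k\end{bmatrix}x^{2n-2k}.$$ -/

import Mathlib

open Finset

/-- The Carlitz `q`-Catalan numbers `C_n(q)`: `C_0(q) = 1` and
`C_{n+1}(q) = ∑_{i=0}^n C_i(q) q^{n-i} C_{n-i}(q)`, which is the functional equation
`f(z) = 1 + z f(z) f(qz)` of their generating function, read coefficientwise. -/
def carlitzCatalan {R : Type*} [CommRing R] (q : R) : ℕ → R
  | 0 => 1
  | n + 1 => ∑ i : Fin (n + 1),
      carlitzCatalan q i.1 * (q ^ (n - i.1) * carlitzCatalan q (n - i.1))
  decreasing_by all_goals omega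

/-- The sequence `carlitzCatalan q` is the unique one whose generating function satisfies
`f(z) = 1 + z f(z) f(qz)`. -/
theorem carlitzCatalan_unique {R : Type*} [CommRing R] (q : R) (f : PowerSeries R) :
    f = 1 + PowerSeries.X * f * PowerSeries.rescale q f ↔
      f = PowerSeries.mk (carlitzCatalan q) := by
  have key : ∀ g : PowerSeries R, g = 1 + PowerSeries.X * g * PowerSeries.rescale q g ↔
      PowerSeries.coeff 0 g = 1 ∧ ∀ n, PowerSeries.coeff (n + 1) g =
        ∑ i : Fin (n + 1), PowerSeries.coeff i.1 g *
          (q ^ (n - i.1) * PowerSeries.coeff (n - i.1) g) := by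
    intro g
    rw [PowerSeries.ext_iff]
    have h0 : PowerSeries.coeff 0 (1 + PowerSeries.X * g * PowerSeries.rescale q g) = 1 := by
      simp [mul_assoc]
    have h1 : ∀ n, PowerSeries.coeff (n + 1)
        (1 + PowerSeries.X * g * PowerSeries.rescale q g) =
        ∑ i : Fin (n + 1), PowerSeries.coeff i.1 g *
          (q ^ (n - i.1) * PowerSeries.coeff (n - i.1) g) := by
      intro n
      rw [mul_assoc, map_add, PowerSeries.coeff_succ_X_mul, PowerSeries.coeff_mul,
        Finset.Nat.sum_antidiagonal_eq_sum_range_succ_mk, Finset.sum_range]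
      simp [PowerSeries.coeff_one, PowerSeries.coeff_rescale]
    constructor
    · intro h
      exact ⟨(h 0).trans h0, fun n => (h (n + 1)).trans (h1 n)⟩
    · rintro ⟨a, b⟩ (_ | n)
      · exact a.trans h0.symm
      · exact (b n).trans (h1 n).symm
  rw [key]
  constructor
  · rintro ⟨a, b⟩
    ext n
    rw [PowerSeries.coeff_mk]
    induction n using Nat.strong_induction_on with
    | _ n ih =>
      rcases n with _ | n
      · rw [a, carlitzCatalan]
      · rw [b, carlitzCatalan]
        refine Finset.sum_congr rfl fun i _ => ?_
        rw [ih _ (by omega), ih _ (by omega)]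
  · rintro rfl
    simp only [PowerSeries.coeff_mk]
    exact ⟨by rw [carlitzCatalan], fun n => by rw [carlitzCatalan]⟩

/-- The polynomials `r(n, x) = ∑_{k=0}^n a(n-k) x^k`. -/
def hankelPoly {R : Type*} [CommRing R] (a : ℕ → R) (n : ℕ) (x : R) : R :=
  ∑ k ∈ range (n + 1), a (n - k) * x ^ k

/-- The Hankel determinant `d(n, x) = det (r(i+j, x))_{i,j=0}^n`. -/
def hankelDet {R : Type*} [CommRing R] (a : ℕ → R) (n : ℕ) (x : R) : R :=
  (Matrix.of fun i j : Fin (n + 1) => hankelPoly a (i.1 + j.1) x).det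

/-- The Gaussian binomial coefficient, through the `q`-Pascal rule, so that it is the value at
`q` of the usual polynomial, also when `q` is a root of unity. -/
def qBinomial {R : Type*} [CommRing R] (q : R) : ℕ → ℕ → R
  | _, 0 => 1
  | 0, _ + 1 => 0
  | n + 1, k + 1 => qBinomial q n k + q ^ (k + 1) * qBinomial q n (k + 1)

/-- The product formula for the Gaussian binomial coefficients, with denominators cleared. -/
theorem qBinomial_mul_prod {R : Type*} [CommRing R] (q : R) (n k : ℕ) :
    qBinomial q n k * ∏ i ∈ range k, (1 - q ^ (i + 1)) = ∏ i ∈ range k, (1 - q ^ (n - i)) := by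
  induction n generalizing k with
  | zero =>
    rcases k with _ | k
    · simp [qBinomial]
    · simp [qBinomial]
  | succ n ih =>
    rcases k with _ | k
    · simp [qBinomial]
    · have e1 := ih k
      have e2 := ih (k + 1)
      rw [Finset.prod_range_succ, Finset.prod_range_succ] at e2
      rw [qBinomial, Finset.prod_range_succ, Finset.prod_range_succ']
      simp only [Nat.add_sub_add_right, Nat.sub_zero]
      rcases Nat.lt_or_ge n k with h | h
      · have z : ∏ i ∈ range k, (1 - q ^ (n - i)) = 0 :=
          Finset.prod_eq_zero (Finset.mem_range.2 h) (by simp)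
        rw [z] at e1 e2 ⊢
        linear_combination (1 - q ^ (k + 1)) * e1 + q ^ (k + 1) * e2
      · have p : q ^ (n + 1) = q ^ (k + 1) * q ^ (n - k) := by
          rw [← pow_add]; congr 1; omega
        rw [p]
        linear_combination (1 - q ^ (k + 1)) * e1 + q ^ (k + 1) * e2

/-- The Carlitz `q`-Fibonacci polynomials: `F_0 = 0`, `F_1 = 1` and
`F_n(x, s, q) = x F_{n-1}(x, s, q) + q^{n-3} s F_{n-2}(x, s, q)`. -/
def qFibonacci {K : Type*} [Field K] (x s q : K) : ℕ → K
  | 0 => 0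
  | 1 => 1
  | n + 2 => x * qFibonacci x s q (n + 1) + q ^ ((n : ℤ) - 1) * s * qFibonacci x s q n

/-! Let `f` be the Carlitz–Catalan series and `P_k` the `fibSeries`. Iterating the functional
equation gives `P_{k+1}(z) f(z) = P_k(qz) + O(z^{k+1})`, a Padé approximation
(`fibSeries_mul_carlitzCatalan`). As `P_{2n+1}` has degree at most `n`, its reversed coefficients
combine the columns of the Hankel matrix. Once row operations have removed `x` from all rows but the
first, this combination vanishes in those rows, while the first gives `P_{2n}(qz)`, reversed and
evaluated at `x`. So `d(n, x)` is, up to sign, that polynomial times a minor free of `x`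
(`hankelDet_carlitzCatalan`). The minor is a power of `q` by the same trick and cancels in the
quotient. The polynomial at `x^2` is `F_{2n+1}` (`qFibonacci_succ_eq_sum`), with coefficients from
`coeff_fibSeries`. -/

open PowerSeries in
/-- The reversed orthogonal polynomials attached to the Stieltjes continued fraction
`1 / (1 - z / (1 - q z / (1 - q² z / ⋯)))`, as power series. -/
noncomputable def fibSeries {R : Type*} [CommRing R] (q : R) : ℕ → PowerSeries R
  | 0 => 1
  | 1 => 1
  | k + 2 => fibSeries q (k + 1) - C (q ^ k) * (X * fibSeries q k)

/-! ### Coefficients of the continued fraction denominators -/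

section Series

open PowerSeries

variable {R : Type*} [CommRing R] (q : R)

theorem coeff_zero_fibSeries (k : ℕ) : coeff 0 (fibSeries q k) = 1 := by
  induction k using Nat.strong_induction_on with
  | _ k ih =>
    match k with
    | 0 => simp [fibSeries]
    | 1 => simp [fibSeries]
    | k + 2 =>
      rw [fibSeries, map_sub, ih (k + 1) (by omega), coeff_C_mul, coeff_zero_X_mul]
      simp

theorem coeff_succ_fibSeries (k m : ℕ) :
    coeff (m + 1) (fibSeries q (k + 2)) =
      coeff (m + 1) (fibSeries q (k + 1)) - q ^ k * coeff m (fibSeries q k) := by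
  rw [fibSeries, map_sub, coeff_C_mul, coeff_succ_X_mul]

theorem coeff_fibSeries_eq_zero {k m : ℕ} (h : k < 2 * m) : coeff m (fibSeries q k) = 0 := by
  induction k using Nat.strong_induction_on generalizing m with
  | _ k ih =>
    obtain ⟨m, rfl⟩ : ∃ l, m = l + 1 := ⟨m - 1, by omega⟩
    match k with
    | 0 => simp [fibSeries, coeff_one]
    | 1 => simp [fibSeries, coeff_one]
    | k + 2 =>
      rw [coeff_succ_fibSeries, ih (k + 1) (by omega) (by omega), ih k (by omega) (by omega)]
      simp

theorem qBinomial_eq_zero {n k : ℕ} (h : n < k) : qBinomial q n k = 0 := by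
  induction n generalizing k with
  | zero =>
    obtain ⟨k, rfl⟩ : ∃ l, k = l + 1 := ⟨k - 1, by omega⟩
    simp [qBinomial]
  | succ n ih =>
    obtain ⟨k, rfl⟩ : ∃ l, k = l + 1 := ⟨k - 1, by omega⟩
    rw [qBinomial, ih (by omega), ih (by omega)]
    simp

theorem qBinomial_zero_right (n : ℕ) : qBinomial q n 0 = 1 := by
  cases n <;> rfl

/-- Proved by induction rather than from the product formula, whose factors cannot be cancelled when
`q` is a root of unity. It converts one q-Pascal rule into the other. -/
theorem qBinomial_mul_one_sub {n k : ℕ} (h : k ≤ n) :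
    qBinomial q n k * (1 - q ^ (n - k)) = qBinomial q n (k + 1) * (1 - q ^ (k + 1)) := by
  induction n generalizing k with
  | zero =>
    obtain rfl : k = 0 := by omega
    simp [qBinomial]
  | succ n ih =>
    rcases k with _ | k
    · have e := ih (Nat.zero_le n)
      rw [qBinomial_zero_right] at e ⊢
      rw [qBinomial, qBinomial_zero_right]
      simp only [Nat.sub_zero, zero_add, pow_one] at e ⊢
      linear_combination q * e
    · rcases Nat.lt_or_ge k n with hk | hk
      · obtain ⟨d, rfl⟩ : ∃ d, n = k + 1 + d := ⟨n - (k + 1), by omega⟩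
        have e1 := ih (k := k) (by omega)
        have e2 := ih (k := k + 1) (by omega)
        rw [show k + 1 + d - k = d + 1 by omega] at e1
        rw [show k + 1 + d - (k + 1) = d by omega] at e2
        rw [show k + 1 + d + 1 - (k + 1) = d + 1 by omega, qBinomial, qBinomial]
        linear_combination e1 + q ^ (k + 1 + 1) * e2
      · obtain rfl : k = n := by omega
        rw [qBinomial_eq_zero q (Nat.lt_succ_self (k + 1))]
        simp

theorem qBinomial_succ_succ {n k : ℕ} (h : k ≤ n) :
    qBinomial q (n + 1) (k + 1) = qBinomial q n (k + 1) + q ^ (n - k) * qBinomial q n k := by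
  rw [qBinomial]
  linear_combination qBinomial_mul_one_sub q h

/-- The recurrence of `fibSeries` is the second q-Pascal rule. The factor `q ^ m` is the one
produced by `z ↦ qz`. -/
theorem coeff_fibSeries (k m : ℕ) :
    q ^ m * coeff m (fibSeries q k) = (-1) ^ m * q ^ m ^ 2 * qBinomial q (k - m) m := by
  rcases m with _ | m
  · simp [coeff_zero_fibSeries, qBinomial_zero_right]
  rcases Nat.lt_or_ge k (2 * (m + 1)) with hk | hk
  · rw [coeff_fibSeries_eq_zero q hk, qBinomial_eq_zero q (by omega)]
    simp
  induction k using Nat.strong_induction_on generalizing m with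
  | _ k ih =>
    obtain ⟨d, rfl⟩ : ∃ d, k = 2 * m + d + 2 := ⟨k - 2 * m - 2, by omega⟩
    -- For `d = 0` the index is below the range of the induction hypothesis, and both sides vanish.
    have e1 : q ^ (m + 1) * coeff (m + 1) (fibSeries q (2 * m + d + 1)) =
        (-1) ^ (m + 1) * q ^ (m + 1) ^ 2 * qBinomial q (m + d) (m + 1) := by
      rcases d with _ | d
      · rw [coeff_fibSeries_eq_zero q (by omega), qBinomial_eq_zero q (by omega)]
        simp
      · rw [ih _ (by omega) m (by omega)]
        congr 2
        omega
    have e2 : q ^ m * coeff m (fibSeries q (2 * m + d)) =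
        (-1) ^ m * q ^ m ^ 2 * qBinomial q (m + d) m := by
      rcases m with _ | m
      · simp [coeff_zero_fibSeries, qBinomial_zero_right]
      · rw [ih _ (by omega) m (by omega)]
        congr 2
        omega
    rw [show 2 * m + d + 2 - (m + 1) = m + d + 1 by omega, coeff_succ_fibSeries,
      qBinomial_succ_succ q (by omega : m ≤ m + d), Nat.add_sub_cancel_left]
    linear_combination e1 - q ^ (2 * m + d + 1) * e2

/-! ### Padé approximation of the Carlitz–Catalan series -/

theorem rescale_carlitzCatalan (i : ℕ) :
    rescale (q ^ i) (PowerSeries.mk (carlitzCatalan q)) =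
      1 + C (q ^ i) * X * rescale (q ^ i) (PowerSeries.mk (carlitzCatalan q)) *
        rescale (q ^ (i + 1)) (PowerSeries.mk (carlitzCatalan q)) := by
  have h := congrArg (rescale (q ^ i))
    ((carlitzCatalan_unique q (PowerSeries.mk (carlitzCatalan q))).2 rfl)
  rw [map_add, map_mul, map_mul, map_one, rescale_X, rescale_rescale, ← pow_succ'] at h
  exact h

/-- The convergents of the continued fraction approximate the Carlitz–Catalan series. -/
theorem fibSeries_mul_carlitzCatalan (k : ℕ) :
    fibSeries q (k + 1) * PowerSeries.mk (carlitzCatalan q) =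
      rescale q (fibSeries q k) + C (q ^ (∑ i ∈ range (k + 1), i)) * X ^ (k + 1) *
        ∏ i ∈ range (k + 2), rescale (q ^ i) (PowerSeries.mk (carlitzCatalan q)) := by
  induction k using Nat.strong_induction_on with
  | _ k ih =>
    match k with
    | 0 =>
      have h := rescale_carlitzCatalan q 0
      simp only [pow_zero, rescale_one, RingHom.id_apply, map_one, one_mul] at h
      simpa [fibSeries, Finset.prod_range_succ, mul_assoc] using h
    | 1 =>
      have h0 := rescale_carlitzCatalan q 0
      have h1 := rescale_carlitzCatalan q 1
      simp only [pow_zero, rescale_one, RingHom.id_apply, map_one, one_mul] at h0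
      simp only [fibSeries, Finset.prod_range_succ, Finset.sum_range_succ, pow_zero, rescale_one,
        RingHom.id_apply, map_one, one_mul, Finset.prod_range_zero, Finset.sum_range_zero,
        zero_add, pow_one, mul_one] at h0 h1 ⊢
      linear_combination h0 + X * PowerSeries.mk (carlitzCatalan q) * h1
    | k + 2 =>
      have e1 := ih (k + 1) (by omega)
      have e0 := ih k (by omega)
      have h := rescale_carlitzCatalan q (k + 2)
      have hc : ∀ r : R, rescale q (C r) = C r := by
        intro r
        ext m
        rcases m with _ | m <;> simp [coeff_C]
      have hS : rescale q (fibSeries q (k + 2)) = rescale q (fibSeries q (k + 1)) -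
          C (q ^ (k + 1)) * X * rescale q (fibSeries q k) := by
        rw [fibSeries, map_sub, map_mul, map_mul, rescale_X, hc, pow_succ, map_mul]
        ring
      rw [Finset.prod_range_succ, Finset.sum_range_succ, pow_add, map_mul] at e1
      rw [Finset.prod_range_succ, Finset.prod_range_succ, Finset.sum_range_succ,
        Finset.sum_range_succ, pow_add, pow_add, map_mul, map_mul, hS, fibSeries]
      -- Combining the two remainders leaves a factor `f(q^{k+2}z) - 1`, which the functional
      -- equation `h` turns into the next remainder.
      linear_combination e1 - C (q ^ (k + 1)) * X * e0 +
        C (q ^ (∑ i ∈ range (k + 1), i)) * C (q ^ (k + 1)) * X ^ (k + 2) *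
          (∏ i ∈ range (k + 2), rescale (q ^ i) (PowerSeries.mk (carlitzCatalan q))) * h

theorem coeff_fibSeries_mul_carlitzCatalan_of_lt {k m : ℕ} (h : m ≤ k) :
    coeff m (fibSeries q (k + 1) * PowerSeries.mk (carlitzCatalan q)) =
      coeff m (rescale q (fibSeries q k)) := by
  rw [fibSeries_mul_carlitzCatalan, map_add, mul_assoc, coeff_C_mul, coeff_X_pow_mul',
    if_neg (by omega)]
  simp

theorem coeff_fibSeries_mul_carlitzCatalan_self (k : ℕ) :
    coeff (k + 1) (fibSeries q (k + 1) * PowerSeries.mk (carlitzCatalan q)) =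
      q ^ (∑ i ∈ range (k + 1), i) := by
  have h0 : coeff 0 (∏ i ∈ range (k + 2),
      rescale (q ^ i) (PowerSeries.mk (carlitzCatalan q))) = 1 := by
    rw [coeff_zero_eq_constantCoeff_apply, map_prod]
    refine Finset.prod_eq_one fun i _ => ?_
    rw [← coeff_zero_eq_constantCoeff_apply, coeff_rescale, coeff_mk, carlitzCatalan]
    simp
  rw [fibSeries_mul_carlitzCatalan, map_add, mul_assoc, coeff_C_mul, coeff_X_pow_mul',
    if_pos le_rfl, Nat.sub_self, h0, coeff_rescale, coeff_fibSeries_eq_zero q (by omega)]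
  simp

/-- Reading the product with a series of degree at most `n` as a sum over `Fin (n + 1)`. -/
theorem sum_fin_coeff_mul (A g : PowerSeries R) (n i : ℕ) (hA : ∀ m, n < m → coeff m A = 0) :
    ∑ j : Fin (n + 1), coeff (n - j.1) A * coeff (i + j.1) g = coeff (n + i) (A * g) := by
  rw [coeff_mul, Finset.Nat.sum_antidiagonal_eq_sum_range_succ_mk,
    ← Finset.sum_subset (Finset.range_subset_range.2 (by omega : n + 1 ≤ (n + i).succ)),
    Fin.sum_univ_eq_sum_range (fun j => coeff (n - j) A * coeff (i + j) g),
    ← Finset.sum_range_reflect]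
  · refine Finset.sum_congr rfl fun j hj => ?_
    rw [Finset.mem_range] at hj
    congr 3 <;> omega
  · intro m _ hm
    rw [Finset.mem_range, not_lt] at hm
    rw [hA m (by omega), zero_mul]

theorem hankelPoly_eq_coeff (a : ℕ → R) (n : ℕ) (x : R) :
    hankelPoly a n x = coeff n (PowerSeries.mk (x ^ ·) * PowerSeries.mk a) := by
  rw [coeff_mul, Finset.Nat.sum_antidiagonal_eq_sum_range_succ_mk, hankelPoly]
  refine Finset.sum_congr rfl fun k _ => ?_
  rw [coeff_mk, coeff_mk, mul_comm]

theorem sum_fibSeries_mul_hankelPoly (n : ℕ) (y : R) :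
    ∑ j : Fin (n + 1), coeff (n - j.1) (fibSeries q (2 * n + 1)) *
        hankelPoly (carlitzCatalan q) j.1 y =
      ∑ m ∈ range (n + 1), q ^ m * coeff m (fibSeries q (2 * n)) * y ^ (n - m) := by
  have h := sum_fin_coeff_mul (fibSeries q (2 * n + 1))
    (PowerSeries.mk (y ^ ·) * PowerSeries.mk (carlitzCatalan q)) n 0
    (fun m hm => coeff_fibSeries_eq_zero q (by omega))
  simp only [zero_add, add_zero] at h
  simp only [hankelPoly_eq_coeff, h]
  rw [mul_left_comm, mul_comm, coeff_mul, Finset.Nat.sum_antidiagonal_eq_sum_range_succ_mk]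
  refine Finset.sum_congr rfl fun m hm => ?_
  rw [Finset.mem_range] at hm
  rw [coeff_fibSeries_mul_carlitzCatalan_of_lt q (by omega), coeff_rescale, coeff_mk]

end Series

/-! ### Evaluation of the Hankel determinants -/

section Determinant

variable {R : Type*} [CommRing R]

/-- Expanding a determinant along the last column, after replacing that column by a combination of
the columns that has a single nonzero entry. -/
theorem det_mul_of_mulVec_eq_zero {n : ℕ} (M : Matrix (Fin (n + 1)) (Fin (n + 1)) R)
    (p : Fin (n + 1) → R) (hp : p (Fin.last n) = 1) (i : Fin (n + 1))
    (h : ∀ k, k ≠ i → ∑ j, p j * M k j = 0) :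
    M.det = (-1) ^ (i.1 + n) * (∑ j, p j * M i j) *
      (M.submatrix i.succAbove Fin.castSucc).det := by
  have e := M.det_updateCol_sum (Fin.last n) p
  rw [hp, one_smul] at e
  rw [← e, Matrix.det_succ_column _ (Fin.last n), Finset.sum_eq_single i]
  · rw [Fin.val_last, Matrix.updateCol_self, Fin.succAbove_last]
    simp only [smul_eq_mul]
    congr 2
    ext a b
    simp
  · intro k _ hk
    rw [Matrix.updateCol_self]
    simp only [smul_eq_mul]
    rw [h k hk]
    simp
  · simp

theorem hankelPoly_succ (a : ℕ → R) (n : ℕ) (x : R) :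
    hankelPoly a (n + 1) x = a (n + 1) + x * hankelPoly a n x := by
  rw [hankelPoly, Finset.sum_range_succ', hankelPoly, Finset.mul_sum, add_comm]
  congr 1
  · simp
  · refine Finset.sum_congr rfl fun k _ => ?_
    rw [Nat.add_sub_add_right]
    ring

/-- Subtract `x` times the preceding row from each row but the first. -/
theorem hankelDet_eq_det (a : ℕ → R) (n : ℕ) (x : R) :
    hankelDet a n x = (Matrix.of fun i j : Fin (n + 1) =>
      if i = 0 then hankelPoly a j.1 x else a (i.1 + j.1)).det := by
  refine Matrix.det_eq_of_forall_row_eq_smul_add_pred (fun _ => x) ?_ ?_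
  · intro j
    simp
  · intro i j
    simp only [Matrix.of_apply, Fin.val_succ, Fin.val_castSucc, Fin.succ_ne_zero, if_false]
    rw [Nat.add_right_comm, hankelPoly_succ]

/-- The determinant of the shifted Hankel matrix `a (i + j + 1)`. -/
def shiftedHankelDet (a : ℕ → R) (n : ℕ) : R :=
  (Matrix.of fun i j : Fin n => a (i.1 + 1 + j.1)).det

variable (q : R)

theorem sum_fibSeries_mul_carlitzCatalan (n i : ℕ) :
    ∑ j : Fin (n + 1), PowerSeries.coeff (n - j.1) (fibSeries q (2 * n + 1)) *
        carlitzCatalan q (i + j.1) =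
      PowerSeries.coeff (n + i)
        (fibSeries q (2 * n + 1) * PowerSeries.mk (carlitzCatalan q)) := by
  rw [← sum_fin_coeff_mul _ _ _ _ fun m hm => coeff_fibSeries_eq_zero q (by omega)]
  simp only [PowerSeries.coeff_mk]

theorem sum_fibSeries_mul_carlitzCatalan_eq_zero {n i : ℕ} (h0 : i ≠ 0) (hi : i ≤ n) :
    ∑ j : Fin (n + 1), PowerSeries.coeff (n - j.1) (fibSeries q (2 * n + 1)) *
        carlitzCatalan q (i + j.1) = 0 := by
  rw [sum_fibSeries_mul_carlitzCatalan, coeff_fibSeries_mul_carlitzCatalan_of_lt q (by omega),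
    PowerSeries.coeff_rescale, coeff_fibSeries_eq_zero q (by omega), mul_zero]

/-- Only the last row survives the column combination: it reads coefficient `2n + 1`, the first one
in which the Padé remainder appears. -/
theorem shiftedHankelDet_succ (n : ℕ) :
    shiftedHankelDet (carlitzCatalan q) (n + 1) =
      q ^ (∑ i ∈ range (2 * n + 1), i) * shiftedHankelDet (carlitzCatalan q) n := by
  rcases Nat.eq_zero_or_pos n with rfl | hn
  · simp [shiftedHankelDet, carlitzCatalan]
  rw [shiftedHankelDet, det_mul_of_mulVec_eq_zero _
    (fun j => PowerSeries.coeff (n - j.1) (fibSeries q (2 * n + 1)))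
    (by simp [coeff_zero_fibSeries]) (Fin.last n)]
  · simp only [Matrix.of_apply, Fin.val_last]
    rw [sum_fibSeries_mul_carlitzCatalan, show n + (n + 1) = 2 * n + 1 by omega,
      coeff_fibSeries_mul_carlitzCatalan_self, ← two_mul, pow_mul, Fin.succAbove_last,
      shiftedHankelDet]
    simp [Matrix.submatrix]
  · intro k hk
    have hk' : k.1 < n := Fin.val_lt_last hk
    exact sum_fibSeries_mul_carlitzCatalan_eq_zero q (by omega) (by omega)

theorem hankelDet_carlitzCatalan (n : ℕ) (y : R) :
    hankelDet (carlitzCatalan q) n y =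
      (-1) ^ n * (∑ m ∈ range (n + 1), q ^ m * PowerSeries.coeff m (fibSeries q (2 * n)) *
        y ^ (n - m)) * shiftedHankelDet (carlitzCatalan q) n := by
  rw [hankelDet_eq_det, det_mul_of_mulVec_eq_zero _
    (fun j => PowerSeries.coeff (n - j.1) (fibSeries q (2 * n + 1)))
    (by simp [coeff_zero_fibSeries]) 0]
  · simp only [Matrix.of_apply, if_true]
    rw [sum_fibSeries_mul_hankelPoly, Fin.val_zero, zero_add, shiftedHankelDet]
    congr 2
  · intro k hk
    have hk' : k.1 ≠ 0 := fun h => hk (Fin.ext h)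
    simp only [Matrix.of_apply, if_neg hk]
    exact sum_fibSeries_mul_carlitzCatalan_eq_zero q hk' (by omega)

end Determinant

/-! ### Comparison with the q-Fibonacci polynomials -/

section Field

variable {K : Type*} [Field K]

theorem shiftedHankelDet_ne_zero {q : K} (hq : q ≠ 0) (n : ℕ) :
    shiftedHankelDet (carlitzCatalan q) n ≠ 0 := by
  induction n with
  | zero => simp [shiftedHankelDet]
  | succ n ih =>
    rw [shiftedHankelDet_succ]
    exact mul_ne_zero (pow_ne_zero _ hq) ih

theorem qFibonacci_succ_eq_sum (q x : K) {k N : ℕ} (hN : k < 2 * N) :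
    qFibonacci x (-q) q (k + 1) =
      ∑ m ∈ range N, q ^ m * PowerSeries.coeff m (fibSeries q k) * x ^ (k - 2 * m) := by
  obtain ⟨N, rfl⟩ : ∃ M, N = M + 1 := ⟨N - 1, by omega⟩
  induction k using Nat.strong_induction_on generalizing N with
  | _ k ih =>
    match k with
    | 0 => simp [qFibonacci, fibSeries, PowerSeries.coeff_one]
    | 1 => simp [qFibonacci, fibSeries, PowerSeries.coeff_one]
    | k + 2 =>
      obtain ⟨N, rfl⟩ : ∃ M, N = M + 1 := ⟨N - 1, by omega⟩
      have hz : q ^ (((k + 1 : ℕ) : ℤ) - 1) * -q = -q ^ (k + 1) := by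
        rw [Nat.cast_succ, add_sub_cancel_right, zpow_natCast]
        ring
      rw [qFibonacci, hz, ih (k + 1) (by omega) (N + 1) (by omega), ih k (by omega) N (by omega),
        Finset.sum_range_succ', Finset.sum_range_succ' _ (N + 1), mul_add, Finset.mul_sum,
        Finset.mul_sum, add_right_comm, ← Finset.sum_add_distrib]
      congr 1
      · refine Finset.sum_congr rfl fun m _ => ?_
        rw [coeff_succ_fibSeries, show k + 2 - 2 * (m + 1) = k - 2 * m by omega]
        -- Where the exponent of `x` would be truncated, the coefficient is zero.
        rcases Nat.lt_or_ge (k + 1) (2 * (m + 1)) with h | h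
        · rw [coeff_fibSeries_eq_zero q h]
          ring
        · rw [show k - 2 * m = k + 1 - 2 * (m + 1) + 1 by omega]
          ring
      · simp only [coeff_zero_fibSeries, mul_zero, Nat.sub_zero, pow_zero, mul_one, one_mul]
        ring

end Field

theorem corollary3 {K : Type*} [Field K] (q : K) (hq : q ≠ 0) (n : ℕ) (x : K) :
    hankelDet (carlitzCatalan q) n 0 ≠ 0 ∧
    hankelDet (carlitzCatalan q) n (x ^ 2) / hankelDet (carlitzCatalan q) n 0 =
      (-1) ^ n / q ^ (n ^ 2) * qFibonacci x (-q) q (2 * n + 1) ∧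
    (-1) ^ n / q ^ (n ^ 2) * qFibonacci x (-q) q (2 * n + 1) =
      ∑ k ∈ range (n + 1),
        (-1) ^ (n - k) * q ^ ((k : ℤ) ^ 2 - (n : ℤ) ^ 2) * qBinomial q (2 * n - k) k *
          x ^ (2 * n - 2 * k) := by
  have hs := shiftedHankelDet_ne_zero hq n
  have hqn : q ^ n ^ 2 ≠ 0 := pow_ne_zero _ hq
  have hdiag : ∀ n : ℕ, qBinomial q n n = 1 := by
    intro n
    induction n with
    | zero => rfl
    | succ n ih => rw [qBinomial, ih, qBinomial_eq_zero q (Nat.lt_succ_self n), mul_zero, add_zero]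
  have h0 : hankelDet (carlitzCatalan q) n 0 =
      q ^ n ^ 2 * shiftedHankelDet (carlitzCatalan q) n := by
    -- At `0` only the term `m = n` remains, and its sign cancels `(-1) ^ n`.
    rw [hankelDet_carlitzCatalan, Finset.sum_range_succ, Finset.sum_eq_zero, coeff_fibSeries,
      show 2 * n - n = n by omega, hdiag, Nat.sub_self, zero_add, pow_zero, mul_one, mul_one,
      ← mul_assoc, ← mul_pow]
    · simp
    · intro m hm
      rw [Finset.mem_range] at hm
      rw [zero_pow (by omega), mul_zero]
  have hx : hankelDet (carlitzCatalan q) n (x ^ 2) = (-1) ^ n *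
      qFibonacci x (-q) q (2 * n + 1) * shiftedHankelDet (carlitzCatalan q) n := by
    rw [hankelDet_carlitzCatalan, qFibonacci_succ_eq_sum q x (by omega : 2 * n < 2 * (n + 1))]
    simp only [← pow_mul, Nat.mul_sub]
  refine ⟨h0 ▸ mul_ne_zero hqn hs, ?_, ?_⟩
  · rw [h0, hx]
    field_simp
  · rw [qFibonacci_succ_eq_sum q x (by omega : 2 * n < 2 * (n + 1)), Finset.mul_sum]
    refine Finset.sum_congr rfl fun k hk => ?_
    rw [Finset.mem_range] at hk
    obtain ⟨d, rfl⟩ : ∃ d, n = k + d := ⟨n - k, by omega⟩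
    have hsign : ((-1 : K)) ^ (k + d) * (-1) ^ k = (-1) ^ d := by
      rw [pow_add, mul_right_comm, ← mul_pow]
      simp
    have hpow : q ^ ((k : ℤ) ^ 2 - ((k + d : ℕ) : ℤ) ^ 2) = q ^ k ^ 2 / q ^ (k + d) ^ 2 := by
      rw [zpow_sub₀ hq]
      norm_cast
    rw [coeff_fibSeries, hpow, Nat.add_sub_cancel_left, ← hsign]
    ring
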